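/- For a positive integer $k$, let $\Omega(3,k)$ be the smallest positive integer $n$ such that every set $\{x_1, x_2, \dots, x_n\}$ of integers with $x_i \in [(i-1)k+1,\, ik]$ for $1 \le i \le n$ contains a 3-term arithmetic progression (that is, three terms $a, a+d, a+2d$ with $d > 0$). Then there exists a constant $c > 0$ such that, for all sufficiently large $k$, $$\Omega(3,k) > k^{c \log k},$$ where $\log$ denotes the natural logarithm. -/

import Mathlib

/-- Every choice of `x i ∈ [(i - 1) k + 1, i k]` for `1 ≤ i ≤ n` yields a set `{x 1, …, x n}`
that contains a 3-term arithmetic progression (with nonzero common difference). -/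
def EveryChoiceHasThreeAP (k n : ℕ) : Prop :=
  ∀ x : ℕ → ℕ, (∀ i ∈ Finset.Icc 1 n, x i ∈ Finset.Icc ((i - 1) * k + 1) (i * k)) →
    ∃ a d : ℕ, 0 < d ∧ ∀ j ∈ Finset.range 3, a + j * d ∈ (Finset.Icc 1 n).image x

/-- `Ω(3,k)`: the smallest `n` such that every set `{x 1, …, x n}` with
`x i ∈ [(i - 1) k + 1, i k]` contains a 3-term arithmetic progression. (If there were no such
`n`, this would be `0`.) -/
noncomputable def omegaThree (k : ℕ) : ℕ :=
  sInf {n : ℕ | EveryChoiceHasThreeAP k n}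

/-! A Behrend-type construction. In block `t + 1` with `t < b ^ D`, choose `k * t + 1 + g t`, where
the offset `g t < k / 2` encodes `halfPattern` and `digitSquareSum` of `t`. A progression among the
choices then forces one in `t` and in both codes. The pattern rules out carries, so the base-`b`
digit vectors are in progression, and strict convexity of the square sum makes them equal. Taking `b
= 2 ^ D` with `128 ^ D ≤ k` handles `2 ^ (D ^ 2)` blocks. -/

/-- The sum of the squares of the `D` lowest digits of `n` in base `b`. -/
def digitSquareSum (b : ℕ) : ℕ → ℕ → ℕ
  | 0, _ => 0
  | D + 1, n => (n % b) ^ 2 + digitSquareSum b D (n / b)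

/-- The number whose `D` ternary digits record which of the `D` lowest digits of `n` in base `b`
lie in the upper half of `[0, b)`. -/
def halfPattern (b : ℕ) : ℕ → ℕ → ℕ
  | 0, _ => 0
  | D + 1, n => (if 2 * (n % b) < b then 0 else 1) + 3 * halfPattern b D (n / b)

lemma digitSquareSum_le (b : ℕ) (hb : 0 < b) (D n : ℕ) : digitSquareSum b D n ≤ D * b ^ 2 := by
  induction D generalizing n with
  | zero => simp [digitSquareSum]
  | succ D ih =>
    have h1 : (n % b) ^ 2 ≤ b ^ 2 := Nat.pow_le_pow_left (Nat.mod_lt _ hb).le 2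
    have h2 := ih (n / b)
    simp only [digitSquareSum]
    linarith

lemma halfPattern_lt (b D n : ℕ) : halfPattern b D n < 3 ^ D := by
  induction D generalizing n with
  | zero => simp [halfPattern]
  | succ D ih =>
    have h := ih (n / b)
    simp only [halfPattern, pow_succ]
    split_ifs <;> omega

/-- Three digits in the same half of `[0, b)` produce no carry in an arithmetic progression. -/
lemma digits_of_add_eq_two_mul {b x y z : ℕ} (hb : 0 < b) (h : x + z = 2 * y)
    (hxy : 2 * (x % b) < b ↔ 2 * (y % b) < b) (hzy : 2 * (z % b) < b ↔ 2 * (y % b) < b) :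
    x % b + z % b = 2 * (y % b) ∧ x / b + z / b = 2 * (y / b) := by
  have hx := Nat.mod_lt x hb
  have hy := Nat.mod_lt y hb
  have hz := Nat.mod_lt z hb
  have ex := Nat.div_add_mod x b
  have ey := Nat.div_add_mod y b
  have ez := Nat.div_add_mod z b
  have key : (b : ℤ) * ((x / b : ℕ) + (z / b : ℕ) - 2 * (y / b : ℕ)) =
      2 * (y % b : ℕ) - (x % b : ℕ) - (z % b : ℕ) := by
    have h' : (x : ℤ) + z = 2 * y := by exact_mod_cast h
    rw [← ex, ← ey, ← ez] at h'
    push_cast at h' ⊢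
    linarith
  have habs : |(2 * (y % b : ℕ) - (x % b : ℕ) - (z % b : ℕ) : ℤ)| < b := by
    rw [abs_lt]
    omega
  have h0 := Int.eq_zero_of_abs_lt_dvd (Dvd.intro _ key) habs
  rw [h0] at key
  have hb' : (b : ℤ) ≠ 0 := by exact_mod_cast hb.ne'
  have h1 := (mul_eq_zero.mp key).resolve_left hb'
  omega

/-- Without carries, each digit triple has `p + r = 2q`, so `(p - r)² = 2(p² + r² - 2q²)`; equality
overall forces `p = r` in every digit. -/
lemma digitSquareSum_strictConvex {b : ℕ} (hb : 0 < b) (D : ℕ) {x y z : ℕ}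
    (hx : x < b ^ D) (hy : y < b ^ D) (hz : z < b ^ D) (h : x + z = 2 * y)
    (hE : halfPattern b D x + halfPattern b D z = 2 * halfPattern b D y) :
    2 * digitSquareSum b D y ≤ digitSquareSum b D x + digitSquareSum b D z ∧
      (2 * digitSquareSum b D y = digitSquareSum b D x + digitSquareSum b D z → x = z) := by
  induction D generalizing x y z with
  | zero =>
    simp only [pow_zero] at hx hz
    simp only [digitSquareSum]
    omega
  | succ D ih =>
    simp only [halfPattern] at hE
    -- Pattern digits are 0 or 1, so sums of two do not carry in base 3 and the lowest ones must
    -- agree.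
    have hxy : 2 * (x % b) < b ↔ 2 * (y % b) < b := by split_ifs at hE <;> omega
    have hzy : 2 * (z % b) < b ↔ 2 * (y % b) < b := by split_ifs at hE <;> omega
    obtain ⟨hm, hd⟩ := digits_of_add_eq_two_mul hb h hxy hzy
    have hlt : ∀ w, w < b ^ (D + 1) → w / b < b ^ D := fun w hw =>
      Nat.div_lt_of_lt_mul (by rwa [pow_succ'] at hw)
    have hE' : halfPattern b D (x / b) + halfPattern b D (z / b) =
        2 * halfPattern b D (y / b) := by
      simp only [hxy, hzy] at hE
      split_ifs at hE <;> omega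
    obtain ⟨h1, h2⟩ := ih (hlt x hx) (hlt y hy) (hlt z hz) hd hE'
    have hsq : (((x % b : ℕ) : ℤ) - (z % b : ℕ)) ^ 2 =
        2 * ((x % b : ℕ) ^ 2 + (z % b : ℕ) ^ 2 - 2 * (y % b : ℕ) ^ 2) := by
      have hm' : ((x % b : ℕ) : ℤ) + (z % b : ℕ) = 2 * (y % b : ℕ) := by exact_mod_cast hm
      linear_combination (-((x % b : ℕ) : ℤ) - (z % b : ℕ) - 2 * (y % b : ℕ)) * hm'
    have hconv : 2 * (y % b) ^ 2 ≤ (x % b) ^ 2 + (z % b) ^ 2 := by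
      zify
      push_cast at hsq
      nlinarith [sq_nonneg (((x : ℤ) % b) - (z : ℤ) % b)]
    simp only [digitSquareSum]
    refine ⟨by omega, fun heq => ?_⟩
    have hdiv := h2 (by omega)
    have hmod : x % b = z % b := by
      have h3 : 2 * (y % b) ^ 2 = (x % b) ^ 2 + (z % b) ^ 2 := by omega
      have h3' : 2 * ((y % b : ℕ) : ℤ) ^ 2 = (x % b : ℕ) ^ 2 + (z % b : ℕ) ^ 2 := by
        exact_mod_cast h3
      have h4 : ((x % b : ℕ) : ℤ) - (z % b : ℕ) = 0 := by
        rw [← sq_eq_zero_iff, hsq]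
        linarith
      omega
    rw [← Nat.div_add_mod x b, ← Nat.div_add_mod z b, hdiv, hmod]

/-- In base `m`, small digits satisfy `2 q = p + r` as soon as the numbers they end do. -/
lemma eq_of_mul_add_eq_of_two_mul_lt {m a b c p q r : ℕ} (hp : 2 * p < m) (hq : 2 * q < m)
    (hr : 2 * r < m) (h : (m * a + p) + (m * c + r) = 2 * (m * b + q)) :
    a + c = 2 * b ∧ p + r = 2 * q := by
  have key : (m : ℤ) * (a + c - 2 * b) = 2 * q - p - r := by
    have h' : ((m : ℤ) * a + p) + (m * c + r) = 2 * (m * b + q) := by exact_mod_cast h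
    linarith
  have habs : |(2 * q - p - r : ℤ)| < m := by
    rw [abs_lt]
    omega
  have h0 := Int.eq_zero_of_abs_lt_dvd (Dvd.intro _ key) habs
  rw [h0] at key
  have hm : (m : ℤ) ≠ 0 := by omega
  have h1 := (mul_eq_zero.mp key).resolve_left hm
  omega

lemma not_everyChoiceHasThreeAP_of_le_pow {b D k n : ℕ} (hb : 0 < b)
    (hk : 2 * (3 ^ D * (2 * (D * b ^ 2) + 1)) ≤ k) (hn : n ≤ b ^ D) :
    ¬ EveryChoiceHasThreeAP k n := by
  intro hAP
  set m := 2 * (D * b ^ 2) + 1 with hm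
  have hQ : ∀ t, 2 * digitSquareSum b D t < m := fun t => by
    have := digitSquareSum_le b hb D t
    omega
  let g : ℕ → ℕ := fun t => m * halfPattern b D t + digitSquareSum b D t
  have hg : ∀ t, 2 * g t < k := fun t => by
    have h1 := Nat.mul_le_mul_left m (halfPattern_lt b D t)
    have h2 := hQ t
    rw [Nat.mul_succ, mul_comm m (3 ^ D)] at h1
    simp only [g]
    omega
  obtain ⟨a, d, hd, hmem⟩ := hAP (fun i => (i - 1) * k + 1 + g (i - 1)) (by
    intro i hi
    rw [Finset.mem_Icc] at hi ⊢
    obtain ⟨t, rfl⟩ : ∃ t, i = t + 1 := ⟨i - 1, by omega⟩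
    have := hg t
    simp only [Nat.add_sub_cancel, add_mul, one_mul]
    omega)
  have hget : ∀ j ∈ Finset.range 3, ∃ t < b ^ D, k * t + g t + 1 = a + j * d := by
    intro j hj
    obtain ⟨i, hi, hij⟩ := Finset.mem_image.mp (hmem j hj)
    rw [Finset.mem_Icc] at hi
    refine ⟨i - 1, by omega, ?_⟩
    rw [← hij]
    ring
  obtain ⟨x, hx, ex⟩ := hget 0 (by simp)
  obtain ⟨y, hy, ey⟩ := hget 1 (by simp)
  obtain ⟨z, hz, ez⟩ := hget 2 (by simp)
  obtain ⟨hxyz, hgxyz⟩ := eq_of_mul_add_eq_of_two_mul_lt (m := k) (a := x) (b := y) (c := z)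
    (hg x) (hg y) (hg z) (by omega)
  obtain ⟨hE, hS⟩ := eq_of_mul_add_eq_of_two_mul_lt (hQ x) (hQ y) (hQ z) hgxyz
  have hxz := (digitSquareSum_strictConvex hb D hx hy hz hxyz hE).2 hS.symm
  subst hxz
  omega

/-- A form of Roth's theorem: choices from sufficiently many consecutive blocks contain a
3-term arithmetic progression. -/
lemma exists_everyChoiceHasThreeAP {k : ℕ} (hk : 0 < k) : ∃ n, EveryChoiceHasThreeAP k n := by
  have ho := rothNumberNat_isLittleO_id.def (c := 1 / (2 * ((k : ℝ) + 1))) (by positivity)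
  obtain ⟨m₀, hm₀⟩ := Filter.eventually_atTop.mp ho
  refine ⟨m₀ + 1, fun x hx => ?_⟩
  set n := m₀ + 1 with hn
  -- The density `1 / (2 * (k + 1))` suffices since `n * k + 1 < 2 * (k + 1) * n`.
  have hlt : (rothNumberNat (n * k + 1) : ℝ) < n := by
    have h := hm₀ (n * k + 1) (by nlinarith)
    simp only [Real.norm_natCast] at h
    refine h.trans_lt ?_
    have hn1 : (1 : ℝ) ≤ n := by exact_mod_cast Nat.le_add_left 1 m₀
    rw [div_mul_eq_mul_div, div_lt_iff₀ (by positivity)]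
    push_cast
    nlinarith [(Nat.cast_nonneg k : (0 : ℝ) ≤ k)]
  have hlt' : rothNumberNat (n * k + 1) < n := by exact_mod_cast hlt
  have hblock : ∀ i ∈ Finset.Icc 1 n, (i - 1) * k + 1 ≤ x i ∧ x i ≤ i * k := fun i hi =>
    Finset.mem_Icc.mp (hx i hi)
  have hmono : ∀ i ∈ Finset.Icc 1 n, ∀ j ∈ Finset.Icc 1 n, i < j → x i < x j := by
    intro i hi j hj hij
    have h1 := (hblock i hi).2
    have h2 := (hblock j hj).1
    have h3 : i * k ≤ (j - 1) * k := Nat.mul_le_mul_right k (by omega)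
    omega
  have hinj : Set.InjOn x (Finset.Icc 1 n : Finset ℕ) := by
    intro i hi j hj hij
    rcases lt_trichotomy i j with h | h | h
    · exact absurd hij (hmono i hi j hj h).ne
    · exact h
    · exact absurd hij (hmono j hj i hi h).ne'
  have hcard : ((Finset.Icc 1 n).image x).card = n := by
    rw [Finset.card_image_of_injOn hinj, Nat.card_Icc, Nat.add_sub_cancel]
  have hnot : ¬ ThreeAPFree (((Finset.Icc 1 n).image x : Finset ℕ) : Set ℕ) := by
    intro hfree
    have h := hfree.le_rothNumberNat ((Finset.Icc 1 n).image x) (n := n * k + 1) (k := n) (by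
      intro y hy
      obtain ⟨i, hi, rfl⟩ := Finset.mem_image.mp hy
      have h1 := (hblock i hi).2
      have h2 : i * k ≤ n * k := Nat.mul_le_mul_right k (Finset.mem_Icc.mp hi).2
      omega) hcard
    omega
  simp only [ThreeAPFree, not_forall] at hnot
  obtain ⟨a, ha, b, hb, c, hc, habc, hab⟩ := hnot
  rw [Finset.mem_coe] at ha hb hc
  have hAP : ∀ p d : ℕ, p ∈ (Finset.Icc 1 n).image x → p + d ∈ (Finset.Icc 1 n).image x →
      p + 2 * d ∈ (Finset.Icc 1 n).image x →
      ∀ j ∈ Finset.range 3, p + j * d ∈ (Finset.Icc 1 n).image x := by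
    intro p d h0 h1 h2 j hj
    rw [Finset.mem_range] at hj
    interval_cases j
    · simpa only [zero_mul, add_zero] using h0
    · simpa only [one_mul] using h1
    · exact h2
  rcases lt_or_gt_of_ne hab with h | h
  · exact ⟨a, b - a, by omega, hAP _ _ ha (by rwa [show a + (b - a) = b by omega])
      (by rwa [show a + 2 * (b - a) = c by omega])⟩
  · exact ⟨c, b - c, by omega, hAP _ _ hc (by rwa [show c + (b - c) = b by omega])
      (by rwa [show c + 2 * (b - c) = a by omega])⟩

lemma two_pow_sq_lt_omegaThree {D k : ℕ} (hk : 128 ^ D ≤ k) (hD : 0 < D) :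
    2 ^ (D ^ 2) < omegaThree k := by
  have hk0 : 0 < k := lt_of_lt_of_le (by positivity) hk
  -- Roth's theorem excludes the default `sInf ∅ = 0`, so the infimum is attained.
  have hmem : EveryChoiceHasThreeAP k (omegaThree k) :=
    Nat.sInf_mem (exists_everyChoiceHasThreeAP hk0)
  by_contra hle
  refine not_everyChoiceHasThreeAP_of_le_pow (b := 2 ^ D) (D := D) (by positivity) ?_ ?_ hmem
  · refine le_trans ?_ hk
    have h1 : 2 * D ≤ 2 ^ D := by
      obtain ⟨t, rfl⟩ : ∃ t, D = t + 1 := ⟨D - 1, by omega⟩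
      have := (Nat.lt_two_pow_self : t < 2 ^ t)
      rw [pow_succ]
      omega
    have h2 : 2 * (D * (2 ^ D) ^ 2) + 1 ≤ 2 * (2 ^ D) ^ 3 := by
      have := Nat.mul_le_mul_right ((2 ^ D) ^ 2) h1
      have := Nat.one_le_pow 3 (2 ^ D) (by positivity)
      nlinarith
    have h4 : 4 ≤ 4 ^ D := Nat.le_self_pow hD.ne' 4
    calc 2 * (3 ^ D * (2 * (D * (2 ^ D) ^ 2) + 1))
        ≤ 2 * (3 ^ D * (2 * (2 ^ D) ^ 3)) := by gcongr
      _ = 4 * (3 ^ D * (2 ^ D) ^ 3) := by ring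
      _ ≤ 4 ^ D * (4 ^ D * (2 ^ D) ^ 3) := by
          gcongr
          norm_num
      _ = 128 ^ D := by
          rw [← pow_mul, mul_comm D 3, pow_mul, ← mul_pow, ← mul_pow]
          norm_num
  · rw [← pow_mul, ← sq]
    exact not_lt.mp hle

theorem mainTheorem7 :
    ∃ c : ℝ, 0 < c ∧ ∃ K : ℕ, ∀ k : ℕ, K ≤ k →
      (k : ℝ) ^ (c * Real.log (k : ℝ)) < (omegaThree k : ℝ) := by
  -- `196 = 14 ^ 2`, from `log k ≤ 7 (D + 1) log 2 ≤ 14 D log 2`.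
  refine ⟨1 / 196, by norm_num, 128, fun k hk => ?_⟩
  have hk0 : k ≠ 0 := by omega
  set D := Nat.log 128 k with hDdef
  have hD : 0 < D := Nat.log_pos (by norm_num) hk
  have hlow := two_pow_sq_lt_omegaThree (Nat.pow_log_le_self 128 hk0) hD
  have hup : k < 128 ^ (D + 1) := Nat.lt_pow_succ_log_self (by norm_num) k
  have hkpos : (0 : ℝ) < k := by exact_mod_cast Nat.pos_of_ne_zero hk0
  have hl2 : 0 < Real.log 2 := Real.log_pos (by norm_num)
  have hl2' : Real.log 2 ≤ 1 := by linarith [Real.log_two_lt_d9]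
  have hlog0 : 0 ≤ Real.log k := Real.log_natCast_nonneg k
  have hlog : Real.log k ≤ 14 * D * Real.log 2 := by
    have h1 : Real.log k ≤ Real.log ((128 : ℝ) ^ (D + 1)) :=
      Real.log_le_log hkpos (by exact_mod_cast hup.le)
    rw [Real.log_pow, show (128 : ℝ) = 2 ^ 7 by norm_num, Real.log_pow] at h1
    have hD1 : (1 : ℝ) ≤ D := by exact_mod_cast hD
    push_cast at h1
    nlinarith
  calc (k : ℝ) ^ (1 / 196 * Real.log k) = Real.exp (Real.log k ^ 2 / 196) := by
        rw [Real.rpow_def_of_pos hkpos]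
        ring_nf
    _ ≤ Real.exp (Real.log 2 * (D ^ 2 : ℕ)) := by
        rw [Real.exp_le_exp]
        have h1 : Real.log k ^ 2 ≤ (14 * D * Real.log 2) ^ 2 := pow_le_pow_left₀ hlog0 hlog 2
        have h2 : Real.log 2 * ((D : ℝ) ^ 2 * Real.log 2) ≤ 1 * ((D : ℝ) ^ 2 * Real.log 2) :=
          mul_le_mul_of_nonneg_right hl2' (by positivity)
        push_cast
        linarith
    _ = ((2 ^ (D ^ 2) : ℕ) : ℝ) := by
        rw [← Real.rpow_def_of_pos (by norm_num), Real.rpow_natCast]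
        push_cast
        rfl
    _ < omegaThree k := by exact_mod_cast hlow
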